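/- Let $F$ be a nonarchimedean local field of characteristic different from $2$, with ring of integers $\mathfrak{o}$ and maximal ideal $\mathfrak{p}$. Let $H$ be a quaternion division algebra over $F$ (a central division algebra of dimension $4$), with reduced norm $\mathrm{nrd}(h) = \overline{h}h$, and let $\ddagger$ be an orthogonal involution of $H$, that is, an $F$-linear map with $(xy)^\ddagger = y^\ddagger x^\ddagger$ and $(x^\ddagger)^\ddagger = x$ for which $H^+ = \{x : x^\ddagger = x\}$ has dimension $3$ and $H^- = \{x : x^\ddagger = -x\}$ has dimension $1$. A $\ddagger$-order is an $\mathfrak{o}$-order $\mathcal{O}$ of $H$ with $\mathcal{O} = \mathcal{O}^\ddagger$; it is a maximal $\ddagger$-order if it is not properly contained in any other $\ddagger$-order. Let $\mathrm{disc}(\mathcal{O})$ denote the reduced discriminant of an order $\mathcal{O}$, i.e. the ideal of $\mathfrak{o}$ whose square is generated by the determinants $\det(\mathrm{trd}(x_i x_j))_{1 \le i,j \le 4}$ with $x_1, \dots, x_4 \in \mathcal{O}$. Let $\mathrm{disc}(H)$ be the product of the ramified primes of $H$, i.e. $\mathfrak{o}$ if $H \cong \mathrm{Mat}(2,F)$ and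 $\mathfrak{p}$ otherwise. Let $\mathrm{disc}(\ddagger) \in F^\times/(F^\times)^2$ be the class of $\mathrm{nrd}(h)$ for any nonzero $h \in H^-$, and for a class $\delta \in F^\times/(F^\times)^2$ let $\iota(\delta) = \bigcup_{\lambda \in \delta \cap \mathfrak{o}} \lambda\mathfrak{o}$, an ideal of $\mathfrak{o}$. Then there is a unique maximal $\ddagger$-order of $H$, namely $$\mathcal{O} = \{h \in H : \mathrm{nrd}(h) \in \mathfrak{o}\}.$$ It is also the unique maximal order of $H$, and $$\mathrm{disc}(\mathcal{O}) = \mathfrak{p} = \mathrm{disc}(H) \cap \iota(\mathrm{disc}(\ddagger)).$$ -/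

import Mathlib

open scoped ValuativeRel
open Module

/-! ## Quaternion algebras: reduced trace, conjugation, reduced norm

Here `H` is a quaternion algebra, i.e. a four-dimensional central simple algebra, over a field `F`
of characteristic different from two. -/

section Quaternion

variable (F : Type*) {H : Type*} [Field F] [Ring H] [Algebra F H]

/-- The reduced trace on a quaternion algebra: half of the trace of left multiplication. -/
noncomputable def quatTrd (x : H) : F :=
  LinearMap.trace F H (LinearMap.mulLeft F x) / 2

/-- Quaternion conjugation `x ↦ trd x - x`, the standard involution. -/
noncomputable def quatConj (x : H) : H := algebraMap F H (quatTrd F x) - x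

/-- The reduced norm on a quaternion algebra. The element `conj x * x` lies in `F`, so it is half
of its own reduced trace; see `algebraMap_quatNrd` for the identity `nrd x = conj x * x`. -/
noncomputable def quatNrd (x : H) : F := quatTrd F (quatConj F x * x) / 2

end Quaternion

/-! ## Involutions -/

section Involution

variable {F H : Type*} [Field F] [Ring H] [Algebra F H]

/-- The space `H⁺` of elements fixed by `σ`. -/
def symmElems (σ : H →ₗ[F] H) : Submodule F H := LinearMap.ker (σ - LinearMap.id)

/-- The space `H⁻` of elements negated by `σ`. -/
def skewElems (σ : H →ₗ[F] H) : Submodule F H := LinearMap.ker (σ + LinearMap.id)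

/-- An orthogonal involution of a quaternion algebra: an `F`-linear anti-automorphism of order
dividing two with `dim H⁺ = 3` and `dim H⁻ = 1`. -/
structure IsOrthogonalInvolution (σ : H →ₗ[F] H) : Prop where
  map_mul : ∀ x y, σ (x * y) = σ y * σ x
  involutive : ∀ x, σ (σ x) = x
  finrank_symm : finrank F (symmElems σ) = 3
  finrank_skew : finrank F (skewElems σ) = 1

variable (F) in
/-- The group `Fˣ / (Fˣ)²` of square classes. -/
abbrev SquareClasses : Type _ := Fˣ ⧸ (powMonoidHom 2 : Fˣ →* Fˣ).range

open Classical in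
/-- The discriminant of an orthogonal involution: the square class of `nrd h`, for any `h ∈ H⁻`
whose reduced norm is not zero (`involutionDisc_eq` says that the choice does not matter). -/
noncomputable def involutionDisc (σ : H →ₗ[F] H) : SquareClasses F :=
  if h : ∃ u : Fˣ, ∃ x ∈ skewElems σ, quatNrd F x = u then
    QuotientGroup.mk h.choose
  else 1

end Involution

/-! ## Orders, maximal orders and discriminants over a local field -/

section Orders

variable {F H : Type*} [Field F] [ValuativeRel F] [Ring H] [Algebra F H]

/-- An order: a subring that is a full lattice, i.e. a finitely generated `𝔬`-module which spans
`H` over `F`. -/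
def IsOrder (O : Subalgebra 𝒪[F] H) : Prop :=
  Submodule.IsLattice F (Subalgebra.toSubmodule O)

/-- A maximal order. -/
def IsMaximalOrder (O : Subalgebra 𝒪[F] H) : Prop := Maximal IsOrder O

/-- An order that is mapped onto itself by `σ`. -/
def IsInvolutionOrder (σ : H →ₗ[F] H) (O : Subalgebra 𝒪[F] H) : Prop :=
  IsOrder O ∧ σ '' (O : Set H) = (O : Set H)

/-- A `σ`-stable order that is not properly contained in any other `σ`-stable order. -/
def IsMaximalInvolutionOrder (σ : H →ₗ[F] H) (O : Subalgebra 𝒪[F] H) : Prop :=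
  Maximal (IsInvolutionOrder σ) O

/-- The ideal of `𝔬` generated by all `det (trd (xᵢ xⱼ))` with `x₁, …, x₄ ∈ O`. -/
noncomputable def traceFormDisc (O : Subalgebra 𝒪[F] H) : Ideal 𝒪[F] :=
  Ideal.span {d | ∃ x : Fin 4 → H, (∀ i, x i ∈ O) ∧
    (d : F) = (Matrix.of fun i j => quatTrd F (x i * x j)).det}

/-- The (reduced) discriminant of an order: the ideal whose square is the discriminant of the
reduced trace form. (Over a discrete valuation ring there is at most one such ideal, so the
supremum only picks it out.) -/
noncomputable def orderDisc (O : Subalgebra 𝒪[F] H) : Ideal 𝒪[F] :=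
  sSup {I | I ^ 2 = traceFormDisc O}

variable (F H) in
open Classical in
/-- The discriminant of a quaternion algebra over a local field, i.e. the product of the ramified
primes: `𝔬` if `H` is split, and `𝔭` if it is not. -/
noncomputable def quatDisc : Ideal 𝒪[F] :=
  if Nonempty (H ≃ₐ[F] Matrix (Fin 2) (Fin 2) F) then ⊤ else 𝓂[F]

/-- The ideal attached to a square class `δ`: the union of the ideals `a𝔬` over all
`a ∈ δ ∩ 𝔬`. (Ideals of `𝔬` form a chain, so the union is the ideal generated by these `a`.) -/
noncomputable def squareClassIdeal (δ : SquareClasses F) : Ideal 𝒪[F] :=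
  Ideal.span {a | ∃ u : Fˣ, (QuotientGroup.mk u : SquareClasses F) = δ ∧ (a : F) = u}

end Orders

/-! ## The reduced norm and the discriminant of an involution are well defined -/

section WellDefined

variable {F : Type*} [Field F]

theorem quatTrd_smul {H : Type*} [Ring H] [Algebra F H] (c : F) (x : H) :
    quatTrd F (c • x) = c * quatTrd F x := by
  have h : LinearMap.mulLeft F (c • x) = c • LinearMap.mulLeft F x := by
    ext y; simp
  rw [quatTrd, quatTrd, h, map_smul, smul_eq_mul, mul_div_assoc]

theorem quatTrd_add {H : Type*} [Ring H] [Algebra F H] (x y : H) :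
    quatTrd F (x + y) = quatTrd F x + quatTrd F y := by
  have h : LinearMap.mulLeft F (x + y) = LinearMap.mulLeft F x + LinearMap.mulLeft F y := by
    ext z; simp [add_mul]
  rw [quatTrd, quatTrd, quatTrd, h, map_add, add_div]

theorem quatNrd_smul {H : Type*} [Ring H] [Algebra F H] (c : F) (x : H) :
    quatNrd F (c • x) = c ^ 2 * quatNrd F x := by
  have h1 : quatConj F (c • x) = c • quatConj F x := by
    rw [quatConj, quatConj, quatTrd_smul, map_mul, smul_sub, Algebra.smul_def c (algebraMap F H _)]
  rw [quatNrd, quatNrd, h1, smul_mul_smul_comm, quatTrd_smul]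
  ring

theorem involutionDisc_eq {H : Type*} [Ring H] [Algebra F H] (σ : H →ₗ[F] H)
    (hσ : IsOrthogonalInvolution σ) (u : Fˣ) (x : H) (hx : x ∈ skewElems σ)
    (hu : quatNrd F x = u) : involutionDisc σ = QuotientGroup.mk u := by
  have hex : ∃ u : Fˣ, ∃ x ∈ skewElems σ, quatNrd F x = u := ⟨u, x, hx, hu⟩
  rw [involutionDisc, dif_pos hex]
  obtain ⟨y, hy, hyu⟩ := hex.choose_spec
  set w := hex.choose
  have hy0 : (⟨y, hy⟩ : skewElems σ) ≠ 0 := by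
    intro h
    have : y = 0 := congrArg Subtype.val h
    subst this
    have h0 := quatNrd_smul (F := F) (0 : F) (0 : H)
    simp only [zero_smul, ne_eq, OfNat.ofNat_ne_zero, not_false_eq_true, zero_pow, zero_mul] at h0
    exact w.ne_zero (hyu.symm.trans h0)
  obtain ⟨c, hc⟩ := (finrank_eq_one_iff_of_nonzero' _ hy0).1 hσ.finrank_skew ⟨x, hx⟩
  have hc' : c • y = x := congrArg Subtype.val hc
  have hval : (u : F) = c ^ 2 * w := by rw [← hu, ← hc', quatNrd_smul, hyu]
  have hc0 : c ≠ 0 := by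
    rintro rfl
    apply u.ne_zero
    rw [hval]; simp
  rw [QuotientGroup.eq]
  refine ⟨Units.mk0 c hc0, ?_⟩
  ext
  have hw := w.ne_zero
  simp [hval]
  field_simp

/-- Every element of a quaternion division algebra satisfies a monic quadratic equation. -/
theorem exists_quadratic {H : Type*} [DivisionRing H] [Algebra F H] [Algebra.IsCentral F H]
    (hdim : finrank F H = 4) (x : H) :
    ∃ t n : F, x * x = t • x - algebraMap F H n := by
  have hfin : FiniteDimensional F H := FiniteDimensional.of_finrank_pos (by omega)
  set K : Subalgebra F H := Algebra.adjoin F {x} with hK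
  have hxK : x ∈ K := Algebra.subset_adjoin (Set.mem_singleton x)
  have hmul : finrank F K * finrank K H = 4 := by
    let _ : DivisionRing K := divisionRingOfFiniteDimensional F K
    rw [← hdim]
    exact Module.finrank_mul_finrank F K H
  have hne : finrank F K ≠ 4 := by
    intro h4
    have htop : K = ⊤ := by
      apply Subalgebra.toSubmodule_injective
      rw [Algebra.top_toSubmodule]
      exact Submodule.eq_top_of_finrank_eq (h4.trans hdim.symm)
    have hc : Subalgebra.center F H = ⊤ := by
      have h1 : x ∈ Subalgebra.center F H := by
        have h2 : K ≤ Subalgebra.centralizer F {x} := by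
          rw [hK, Algebra.adjoin_le_iff]
          rintro y rfl
          change y ∈ Subalgebra.centralizer F {y}
          rw [Subalgebra.mem_centralizer_iff]
          rintro z rfl
          rfl
        rw [htop] at h2
        rw [Subalgebra.mem_center_iff]
        intro b
        have := (Subalgebra.mem_centralizer_iff F).1 (h2 (Algebra.mem_top : b ∈ ⊤)) x rfl
        exact this.symm
      rw [eq_top_iff, ← htop, hK, Algebra.adjoin_le_iff]
      rintro _ rfl
      exact h1
    have hbot : (⊥ : Subalgebra F H) = ⊤ := by
      rw [eq_top_iff, ← hc]; exact Algebra.IsCentral.out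
    have := Subalgebra.bot_eq_top_iff_finrank_eq_one.1 hbot
    omega
  have hle : finrank F K < 3 := by
    have hdvd : finrank F K ∣ 4 := Dvd.intro _ hmul
    have h5 : finrank F K ≤ 4 := Nat.le_of_dvd (by norm_num) hdvd
    by_contra h6
    have h7 : finrank F K = 3 := by omega
    rw [h7] at hdvd
    omega
  have hdep : ¬ LinearIndependent F (fun i : Fin 3 => (⟨x, hxK⟩ : K) ^ (i : ℕ)) := by
    intro h
    have := h.fintype_card_le_finrank
    simp only [Fintype.card_fin] at this
    omega
  rw [Fintype.not_linearIndependent_iff] at hdep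
  obtain ⟨g, hg, i, hi⟩ := hdep
  have hg' : g 0 • (1 : H) + g 1 • x + g 2 • (x * x) = 0 := by
    have := congrArg (Subtype.val : K → H) hg
    simpa [Fin.sum_univ_three, pow_two] using this
  rw [← Algebra.algebraMap_eq_smul_one] at hg'
  by_cases h2 : g 2 = 0
  · by_cases h1 : g 1 = 0
    · exfalso
      have h0 : g 0 = 0 := by simpa [h1, h2] using hg'
      fin_cases i <;> simp_all
    · refine ⟨-(g 1)⁻¹ * g 0, 0, ?_⟩
      have h3 : x = algebraMap F H (-(g 1)⁻¹ * g 0) := by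
        rw [h2, zero_smul, add_zero] at hg'
        have h4 : g 1 • x = - algebraMap F H (g 0) := eq_neg_of_add_eq_zero_right hg'
        rw [← inv_smul_smul₀ h1 x, h4, Algebra.smul_def, map_mul, map_neg]
        noncomm_ring
      rw [map_zero, sub_zero, Algebra.smul_def, ← h3]
  · refine ⟨-(g 2)⁻¹ * g 1, (g 2)⁻¹ * g 0, ?_⟩
    have h4 : g 2 • (x * x) = -(algebraMap F H (g 0) + g 1 • x) :=
      eq_neg_of_add_eq_zero_right hg'
    rw [← inv_smul_smul₀ h2 (x * x), h4]
    simp only [Algebra.smul_def, map_mul, map_neg]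
    noncomm_ring

theorem algebraMap_quatNrd {H : Type*} [DivisionRing H] [Algebra F H] [Algebra.IsCentral F H]
    (h2 : (2 : F) ≠ 0) (hdim : finrank F H = 4) (x : H) :
    algebraMap F H (quatNrd F x) = quatConj F x * x := by
  have htr1 : ∀ c : F, quatTrd F (algebraMap F H c) = 2 * c := by
    intro c
    have h : LinearMap.mulLeft F (algebraMap F H c) = c • LinearMap.id := by
      ext y; simp [Algebra.smul_def]
    have hfin : FiniteDimensional F H := FiniteDimensional.of_finrank_pos (by omega)
    rw [quatTrd, h, map_smul, LinearMap.trace_id, hdim, smul_eq_mul]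
    field_simp
    norm_num
  obtain ⟨t, n, hx⟩ := exists_quadratic hdim x
  -- it suffices that `conj x * x` is a scalar
  suffices h : ∃ c : F, quatConj F x * x = algebraMap F H c by
    obtain ⟨c, hc⟩ := h
    rw [quatNrd, hc, htr1]
    congr 1
    field_simp
  by_cases hxF : ∃ c : F, x = algebraMap F H c
  · obtain ⟨c, rfl⟩ := hxF
    refine ⟨c * c, ?_⟩
    rw [quatConj, htr1, ← map_sub, ← map_mul]
    congr 1
    ring
  -- the trace of `x - t / 2` vanishes
  set e : F := (t / 2) ^ 2 - n with he
  set z : H := x - algebraMap F H (t / 2) with hz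
  have hcomm : algebraMap F H (t / 2) * x = x * algebraMap F H (t / 2) :=
    Algebra.commutes _ _
  have hzz : z * z = algebraMap F H e := by
    have h3 : t • x = algebraMap F H (t / 2) * x + algebraMap F H (t / 2) * x := by
      rw [← add_mul, ← map_add, Algebra.smul_def]
      congr 2
      field_simp
      norm_num
    have h4 : z * z = x * x - algebraMap F H (t / 2) * x - x * algebraMap F H (t / 2)
        + algebraMap F H (t / 2) * algebraMap F H (t / 2) := by
      rw [hz]; noncomm_ring
    rw [h4, hx, h3, ← hcomm, he, map_sub, map_pow]
    noncomm_ring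
  have hznc : ∃ w : H, z * w ≠ w * z := by
    by_contra! hcon
    have hmem : z ∈ Subalgebra.center F H := by
      rw [Subalgebra.mem_center_iff]
      exact fun b => (hcon b).symm
    obtain ⟨c, hc⟩ := Algebra.mem_bot.1 (Algebra.IsCentral.out hmem)
    apply hxF
    refine ⟨c + t / 2, ?_⟩
    rw [map_add, hc, hz]; simp
  obtain ⟨w, hw⟩ := hznc
  set y : H := z * w - w * z with hy
  have hy0 : y ≠ 0 := sub_ne_zero.2 hw
  have hzy : z * y = -(y * z) := by
    have h5 : z * z * w = w * (z * z) := by rw [hzz]; exact Algebra.commutes _ _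
    have h6 : z * y + y * z = z * z * w - w * (z * z) := by rw [hy]; noncomm_ring
    rw [h5, sub_self] at h6
    exact eq_neg_of_add_eq_zero_left h6
  have htrz : quatTrd F z = 0 := by
    have h7 : quatTrd F (y⁻¹ * (z * y)) = quatTrd F z := by
      rw [quatTrd, quatTrd, LinearMap.mulLeft_mul, LinearMap.mulLeft_mul,
        ← Module.End.mul_eq_comp, ← Module.End.mul_eq_comp, LinearMap.trace_mul_comm, mul_assoc,
        Module.End.mul_eq_comp (LinearMap.mulLeft F y), ← LinearMap.mulLeft_mul,
        mul_inv_cancel₀ hy0, LinearMap.mulLeft_one]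
      rfl
    have h8 : y⁻¹ * (z * y) = (-1 : F) • z := by
      rw [hzy, mul_neg, ← mul_assoc, inv_mul_cancel₀ hy0, one_mul, neg_one_smul]
    rw [h8, quatTrd_smul] at h7
    have h9 : 2 * quatTrd F z = 0 := by linear_combination -h7
    exact (mul_eq_zero.1 h9).resolve_left h2
  have htrx : quatTrd F x = t := by
    have h9 : x = z + algebraMap F H (t / 2) := by rw [hz]; simp
    rw [h9, quatTrd_add, htrz, zero_add, htr1]
    field_simp
  refine ⟨n, ?_⟩
  rw [quatConj, htrx, sub_mul, hx, Algebra.smul_def]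
  abel

end WellDefined

/-! Suppose that |nrd x| < |trd x|². By Hensel's lemma X² - (trd x) X + nrd x splits over `F`; as
`H` has no zero divisors, x is then a scalar c, and |c|² < |2c|² is absurd. So |trd x|² ≤ |nrd x|
always (`valuation_quatTrd_sq_le`). Together with nrd(x + 1) = nrd x + trd x + 1 this makes |nrd| a
nonarchimedean valuation on `H`. Its ring `quatIntegers` is finitely generated because integrality
of traces confines it to a dual lattice, and it contains every order because an order is bounded and
closed under powers. Hence it is the only maximal order, and since the involution preserves nrd it
is also the only maximal stable order.

For the discriminant, Nakayama's lemma shows that the residue ring is larger than the residue field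
of `F`: otherwise `H` would have dimension at most 2. A lift u of a new residue has trd(u)² - 4
nrd(u) a unit, so it generates an unramified quadratic extension. Some j ≠ 0 conjugates u to its
conjugate, and scaling makes nrd j a unit or a uniformizer; the unit case is excluded by
`quatValuation_ne_one_of_conj`. Then 1, u, j, uj is an integral basis of the order, with Gram
determinant a unit times nrd(j)², so the reduced discriminant is 𝔭.

Finally, disc(H) = 𝔭 because `H` is a division algebra, and every square class contains a unit or a
uniformizer, so the ideal of the involution contains 𝔭. -/

/-! ### Identities for the reduced trace and norm -/

section QuaternionIdentities

variable {F : Type*} [Field F]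

section Ring

variable {H : Type*} [Ring H] [Algebra F H]

variable (F H) in
/-- The reduced trace as a linear form. -/
noncomputable def quatTrdLinear : H →ₗ[F] F where
  toFun := quatTrd F
  map_add' := quatTrd_add
  map_smul' := quatTrd_smul

theorem quatTrdLinear_apply (x : H) : quatTrdLinear F H x = quatTrd F x := rfl

theorem quatTrd_sub (x y : H) : quatTrd F (x - y) = quatTrd F x - quatTrd F y :=
  map_sub (quatTrdLinear F H) x y

theorem quatTrd_neg (x : H) : quatTrd F (-x) = -quatTrd F x :=
  map_neg (quatTrdLinear F H) x

theorem quatTrd_zero : quatTrd F (0 : H) = 0 :=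
  map_zero (quatTrdLinear F H)

theorem quatTrd_mul_comm (x y : H) : quatTrd F (x * y) = quatTrd F (y * x) := by
  rw [quatTrd, quatTrd, LinearMap.mulLeft_mul, LinearMap.mulLeft_mul,
    ← Module.End.mul_eq_comp, ← Module.End.mul_eq_comp, LinearMap.trace_mul_comm]

theorem quatTrd_algebraMap (h2 : (2 : F) ≠ 0) (hdim : finrank F H = 4) (c : F) :
    quatTrd F (algebraMap F H c) = 2 * c := by
  have h : LinearMap.mulLeft F (algebraMap F H c) = c • LinearMap.id := by
    ext y; simp [Algebra.smul_def]
  have hfin : FiniteDimensional F H := FiniteDimensional.of_finrank_pos (by omega)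
  rw [quatTrd, h, map_smul, LinearMap.trace_id, hdim, smul_eq_mul]
  field_simp
  norm_num

theorem quatTrd_one (h2 : (2 : F) ≠ 0) (hdim : finrank F H = 4) :
    quatTrd F (1 : H) = 2 := by
  simpa using quatTrd_algebraMap (H := H) h2 hdim 1

end Ring

variable {H : Type*} [DivisionRing H] [Algebra F H]

/-- Conjugation by y preserves the trace and sends x to -x. -/
theorem quatTrd_eq_zero_of_anticommute (h2 : (2 : F) ≠ 0) {x y : H} (hy : y ≠ 0)
    (h : x * y = -(y * x)) : quatTrd F x = 0 := by
  have h7 : quatTrd F (y⁻¹ * (x * y)) = quatTrd F x := by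
    rw [quatTrd_mul_comm, mul_assoc, mul_inv_cancel₀ hy, mul_one]
  rw [h, mul_neg, ← mul_assoc, inv_mul_cancel₀ hy, one_mul, quatTrd_neg] at h7
  have h9 : 2 * quatTrd F x = 0 := by linear_combination -h7
  exact (mul_eq_zero.1 h9).resolve_left h2

theorem quatTrd_two_smul_sub (h2 : (2 : F) ≠ 0) (hdim : finrank F H = 4) (u : H) :
    quatTrd F ((2 : F) • u - algebraMap F H (quatTrd F u)) = 0 := by
  rw [quatTrd_sub, quatTrd_smul, quatTrd_algebraMap h2 hdim, sub_self]

/-- The element 2u - trd u is u minus its conjugate, so conjugating u by j negates it. Unlike u -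
trd(u)/2 it stays integral in residue characteristic 2. -/
theorem mul_two_smul_sub_eq_neg {u j : H} (huj : j * u = quatConj F u * j) :
    j * ((2 : F) • u - algebraMap F H (quatTrd F u)) =
      -(((2 : F) • u - algebraMap F H (quatTrd F u)) * j) := by
  rw [mul_sub, mul_smul_comm, huj, quatConj, ← Algebra.commutes, sub_mul, sub_mul, smul_mul_assoc,
    two_smul, two_smul]
  abel

variable (F H) in
/-- The reduced trace form. -/
noncomputable def quatTrdForm : LinearMap.BilinForm F H :=
  (LinearMap.mul F H).compr₂ (quatTrdLinear F H)

theorem quatTrdForm_nondegenerate (h2 : (2 : F) ≠ 0) (hdim : finrank F H = 4) :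
     (quatTrdForm F H).Nondegenerate := by
  have hl : ∀ x : H, (∀ y, quatTrd F (x * y) = 0) → x = 0 := by
    intro x h
    by_contra hx
    have h1 := h x⁻¹
    rw [mul_inv_cancel₀ hx, quatTrd_one h2 hdim] at h1
    exact h2 h1
  refine ⟨hl, fun x h => hl x fun y => ?_⟩
  rw [quatTrd_mul_comm]
  exact h y

variable [Algebra.IsCentral F H] (h2 : (2 : F) ≠ 0) (hdim : finrank F H = 4)
include h2 hdim

/-- The quadratic equation of x; its polarization below yields every identity for conjugation and
norm. -/
theorem mul_self_eq_quatTrd_smul_sub (x : H) :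
    x * x = quatTrd F x • x - algebraMap F H (quatNrd F x) := by
  rw [algebraMap_quatNrd h2 hdim, quatConj, sub_mul, Algebra.smul_def, sub_sub_cancel]

theorem mul_add_mul_eq_quatTrd (x y : H) :
    x * y + y * x = quatTrd F x • y + quatTrd F y • x
      + algebraMap F H (quatTrd F (x * y) - quatTrd F x * quatTrd F y) := by
  obtain ⟨s, hs⟩ : ∃ s, x * y + y * x = quatTrd F x • y + quatTrd F y • x + algebraMap F H s := by
    refine ⟨-(quatNrd F (x + y) - quatNrd F x - quatNrd F y), ?_⟩
    have hx := mul_self_eq_quatTrd_smul_sub h2 hdim x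
    have hy := mul_self_eq_quatTrd_smul_sub h2 hdim y
    have hxy := mul_self_eq_quatTrd_smul_sub h2 hdim (x + y)
    have : x * y + y * x = (x + y) * (x + y) - x * x - y * y := by noncomm_ring
    rw [this, hxy, hx, hy, quatTrd_add]
    simp only [map_neg, map_sub, smul_add, add_smul]
    abel
  have ht := congrArg (quatTrd F) hs
  rw [quatTrd_add, quatTrd_mul_comm y x, quatTrd_add, quatTrd_add, quatTrd_smul, quatTrd_smul,
    quatTrd_algebraMap h2 hdim] at ht
  -- Polarizing determines the sum only up to a scalar s; comparing traces identifies it.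
  have : s = quatTrd F (x * y) - quatTrd F x * quatTrd F y := by
    apply mul_left_cancel₀ h2
    linear_combination -ht
  rw [hs, this]

theorem quatConj_mul (x y : H) : quatConj F (x * y) = quatConj F y * quatConj F x := by
  have h := mul_add_mul_eq_quatTrd h2 hdim x y
  simp only [quatConj, sub_mul, mul_sub, ← Algebra.commutes (quatTrd F x) y]
  simp only [Algebra.smul_def, map_sub, map_mul] at h ⊢
  have h' : algebraMap F H (quatTrd F (x * y)) = x * y + y * x
      - (algebraMap F H (quatTrd F x) * y + algebraMap F H (quatTrd F y) * x)
      + algebraMap F H (quatTrd F x) * algebraMap F H (quatTrd F y) := by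
    rw [h]; abel
  rw [h', ← map_mul, mul_comm, map_mul]
  abel

theorem quatNrd_mul (x y : H) : quatNrd F (x * y) = quatNrd F x * quatNrd F y := by
  apply (algebraMap F H).injective
  rw [algebraMap_quatNrd h2 hdim, quatConj_mul h2 hdim, map_mul, algebraMap_quatNrd h2 hdim x,
    mul_assoc, ← mul_assoc (quatConj F x), ← algebraMap_quatNrd h2 hdim x, Algebra.left_comm,
    ← algebraMap_quatNrd h2 hdim y, ← map_mul]

theorem quatNrd_algebraMap (c : F) : quatNrd F (algebraMap F H c) = c ^ 2 := by
  apply (algebraMap F H).injective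
  rw [algebraMap_quatNrd h2 hdim, quatConj, quatTrd_algebraMap h2 hdim, ← map_sub, ← map_mul]
  congr 1
  ring

theorem quatNrd_add (x y : H) :
    quatNrd F (x + y) = quatNrd F x + quatNrd F y
      + (quatTrd F x * quatTrd F y - quatTrd F (x * y)) := by
  apply (algebraMap F H).injective
  have hx := mul_self_eq_quatTrd_smul_sub h2 hdim x
  have hy := mul_self_eq_quatTrd_smul_sub h2 hdim y
  have hxy := mul_self_eq_quatTrd_smul_sub h2 hdim (x + y)
  have h := mul_add_mul_eq_quatTrd h2 hdim x y
  have e : (x + y) * (x + y) = x * x + (x * y + y * x) + y * y := by noncomm_ring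
  rw [e, hx, hy, h, quatTrd_add, ← sub_eq_zero] at hxy
  rw [← sub_eq_zero]
  refine Eq.trans ?_ hxy
  simp only [map_add, map_sub, smul_add, add_smul]
  abel

theorem quatNrd_add_algebraMap (x : H) (c : F) :
    quatNrd F (x + algebraMap F H c) = quatNrd F x + c * quatTrd F x + c ^ 2 := by
  rw [quatNrd_add h2 hdim, quatNrd_algebraMap h2 hdim, quatTrd_algebraMap h2 hdim,
    ← Algebra.commutes, ← Algebra.smul_def, quatTrd_smul]
  ring

theorem quatNrd_eq_zero {x : H} : quatNrd F x = 0 ↔ x = 0 := by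
  constructor
  · intro h
    by_contra hx
    have h1 : quatNrd F (x * x⁻¹) = 1 := by
      rw [mul_inv_cancel₀ hx, ← map_one (algebraMap F H), quatNrd_algebraMap h2 hdim, one_pow]
    rw [quatNrd_mul h2 hdim, h, zero_mul] at h1
    exact zero_ne_one h1
  · rintro rfl
    rw [← map_zero (algebraMap F H), quatNrd_algebraMap h2 hdim, zero_pow two_ne_zero]

/-- Applying σ to the quadratic equation of x gives one for σ x. The two equations either have the
same trace, hence the same norm, or force σ x to be a scalar, which σ fixes. -/
theorem IsOrthogonalInvolution.quatNrd_apply {σ : H →ₗ[F] H} (hσ : IsOrthogonalInvolution σ)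
    (x : H) : quatNrd F (σ x) = quatNrd F x := by
  have hσ1 : σ 1 = 1 := by
    have h := hσ.map_mul 1 (σ 1)
    rw [one_mul, hσ.involutive, one_mul] at h
    exact h.symm
  have hσc (c : F) : σ (algebraMap F H c) = algebraMap F H c := by
    rw [Algebra.algebraMap_eq_smul_one, map_smul, hσ1]
  have h := congrArg σ (mul_self_eq_quatTrd_smul_sub h2 hdim x)
  rw [hσ.map_mul, mul_self_eq_quatTrd_smul_sub h2 hdim (σ x), map_sub, map_smul, hσc,
    sub_eq_sub_iff_sub_eq_sub, ← sub_smul, ← map_sub] at h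
  by_cases ht : quatTrd F (σ x) - quatTrd F x = 0
  · rw [ht, zero_smul, eq_comm, map_eq_zero, sub_eq_zero] at h
    exact h
  · rw [← eq_inv_smul_iff₀ ht, Algebra.smul_def, ← _root_.map_mul (algebraMap F H)] at h
    rw [← hσ.involutive x, h, hσc, hσc]

theorem quatNrd_two_smul_sub (u : H) :
    quatNrd F ((2 : F) • u - algebraMap F H (quatTrd F u)) =
      -(quatTrd F u ^ 2 - 4 * quatNrd F u) := by
  rw [sub_eq_add_neg, ← map_neg, quatNrd_add_algebraMap h2 hdim, quatNrd_smul, quatTrd_smul]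
  ring

variable {u j : H} (huj : j * u = quatConj F u * j)
  (hΔ : quatTrd F u ^ 2 - 4 * quatNrd F u ≠ 0)

include hΔ in
theorem two_smul_sub_ne_zero : (2 : F) • u - algebraMap F H (quatTrd F u) ≠ 0 := by
  intro h
  have h' := quatNrd_two_smul_sub h2 hdim u
  rw [h, (quatNrd_eq_zero h2 hdim).2 rfl, eq_comm, neg_eq_zero] at h'
  exact hΔ h'

-- If x commutes with u, then xj anticommutes with 2u - trd u ≠ 0. So F(u) and F(u)j are orthogonal
-- for the trace form.
include hΔ huj in
theorem quatTrd_mul_eq_zero_of_conj {x : H} (hx : u * x = x * u) : quatTrd F (x * j) = 0 := by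
  apply quatTrd_eq_zero_of_anticommute h2 (two_smul_sub_ne_zero h2 hdim hΔ)
  rw [mul_assoc, mul_two_smul_sub_eq_neg huj, mul_neg, ← mul_assoc, ← mul_assoc]
  congr 2
  rw [mul_sub, sub_mul, mul_smul_comm, smul_mul_assoc, hx, Algebra.commutes]

include hΔ huj in
theorem mul_self_eq_of_conj : j * j = algebraMap F H (-quatNrd F j) := by
  have h := quatTrd_mul_eq_zero_of_conj h2 hdim huj hΔ (x := 1) (by rw [mul_one, one_mul])
  rw [one_mul] at h
  rw [mul_self_eq_quatTrd_smul_sub h2 hdim, h, zero_smul, zero_sub, map_neg]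

-- An explicit case of Skolem–Noether: any nonzero commutator uw - wu works, by the quadratic
-- equation of u.
include hΔ in
theorem exists_mul_eq_quatConj_mul : ∃ j : H, j ≠ 0 ∧ j * u = quatConj F u * j := by
  obtain ⟨w, hw⟩ : ∃ w : H, u * w ≠ w * u := by
    by_contra! hcon
    have hmem : u ∈ Subalgebra.center F H := by
      rw [Subalgebra.mem_center_iff]
      exact fun b => (hcon b).symm
    obtain ⟨c, rfl⟩ := Algebra.mem_bot.1 (Algebra.IsCentral.out hmem)
    apply hΔ
    rw [quatTrd_algebraMap h2 hdim, quatNrd_algebraMap h2 hdim]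
    ring
  refine ⟨u * w - w * u, sub_ne_zero.2 hw, ?_⟩
  have h := mul_self_eq_quatTrd_smul_sub h2 hdim u
  have hl : u * u * w = quatTrd F u • (u * w) - quatNrd F u • w := by
    rw [h, sub_mul, smul_mul_assoc, Algebra.smul_def (quatNrd F u)]
  have hr : w * u * u = quatTrd F u • (w * u) - quatNrd F u • w := by
    rw [mul_assoc, h, mul_sub, mul_smul_comm, Algebra.smul_def (quatNrd F u), Algebra.commutes]
  rw [quatConj, sub_mul (algebraMap F H _), ← Algebra.smul_def, smul_sub, mul_sub u, sub_mul,
    ← mul_assoc, ← mul_assoc, hl, hr]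
  abel

end QuaternionIdentities

/-! ### Hensel's lemma, square classes and residue fields of `F` -/

section LocalField

open ValuativeRel

variable {F : Type*} [Field F] [ValuativeRel F] [TopologicalSpace F]
  [IsNonarchimedeanLocalField F]

theorem mem_maximalIdeal_iff_valuation_lt_one {a : 𝒪[F]} :
    a ∈ 𝓂[F] ↔ valuation F (a : F) < 1 := by
  rw [IsLocalRing.mem_maximalIdeal, mem_nonunits_iff,
    Valuation.Integer.not_isUnit_iff_valuation_lt_one]

theorem residue_eq_iff_valuation_sub_lt_one {a b : 𝒪[F]} :
    IsLocalRing.residue 𝒪[F] a = IsLocalRing.residue 𝒪[F] b ↔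
      valuation F ((a : F) - b) < 1 := by
  rw [← sub_eq_zero, ← map_sub, IsLocalRing.residue_eq_zero_iff,
    mem_maximalIdeal_iff_valuation_lt_one]
  rfl

theorem valuation_lt_one_iff_le_irreducible {ϖ : 𝒪[F]} (hϖ : Irreducible ϖ) {a : F} :
    valuation F a < 1 ↔ valuation F a ≤ valuation F (ϖ : F) := by
  constructor
  · intro h
    have hm : (⟨a, h.le⟩ : 𝒪[F]) ∈ 𝓂[F] := mem_maximalIdeal_iff_valuation_lt_one.2 h
    rw [hϖ.maximalIdeal_eq, Ideal.mem_span_singleton] at hm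
    exact (Valuation.integer.integers (valuation F)).le_of_dvd hm
  · exact fun h => h.trans_lt (Valuation.integer.v_irreducible_lt_one hϖ)

/-- Hensel's lemma for `X ^ 2 - X + c` with `c` in the maximal ideal. -/
theorem exists_sq_sub_self_add_eq_zero {c : F} (hc : valuation F c < 1) :
    ∃ r : F, r ^ 2 - r + c = 0 := by
  let := IsTopologicalAddGroup.rightUniformSpace F
  have := isUniformAddGroup_of_addCommGroup (G := F)
  let c' : 𝒪[F] := ⟨c, hc.le⟩
  have hc' : c' ∈ 𝓂[F] := mem_maximalIdeal_iff_valuation_lt_one.2 hc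
  have hmonic : (Polynomial.X ^ 2 - Polynomial.X + Polynomial.C c' :
      Polynomial 𝒪[F]).Monic := by
    have h : (Polynomial.X ^ 2 - Polynomial.X + Polynomial.C c' : Polynomial 𝒪[F]) =
        Polynomial.X ^ 2 + (-Polynomial.X + Polynomial.C c') := by ring
    rw [h]
    apply Polynomial.monic_X_pow_add
    compute_degree!
  -- Modulo the maximal ideal 0 is a simple root: the derivative there is -1.
  obtain ⟨r, hr, -⟩ := HenselianRing.is_henselian (I := 𝓂[F]) _ hmonic 0
    (by simpa using hc') (by simp)
  refine ⟨r, ?_⟩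
  have h := congrArg (Subtype.val : 𝒪[F] → F) hr
  simpa [c'] using h

/-- Up to squares, every nonzero element of a local field is a unit or a uniformizer. -/
theorem exists_sq_mul_valuation_eq {ϖ : 𝒪[F]} (hϖ : Irreducible ϖ) {c : F} (hc : c ≠ 0) :
    ∃ a : F, a ≠ 0 ∧ (valuation F (a ^ 2 * c) = 1 ∨
      valuation F (a ^ 2 * c) = valuation F (ϖ : F)) := by
  have hϖ0 : (ϖ : F) ≠ 0 := fun h => hϖ.ne_zero (Subtype.ext h)
  have key : ∀ c : 𝒪[F], c ≠ 0 → ∃ a : F, a ≠ 0 ∧ (valuation F (a ^ 2 * c) = 1 ∨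
      valuation F (a ^ 2 * c) = valuation F (ϖ : F)) := by
    intro c hc
    obtain ⟨n, u, rfl⟩ := IsDiscreteValuationRing.eq_unit_mul_pow_irreducible hc hϖ
    have hu : valuation F ((u : 𝒪[F]) : F) = 1 :=
      (Valuation.integer.integers (valuation F)).valuation_unit u
    obtain ⟨k, rfl | rfl⟩ := Nat.even_or_odd' n
    · refine ⟨((ϖ : F) ^ k)⁻¹, by simp [hϖ0], Or.inl ?_⟩
      have : (((ϖ : F) ^ k)⁻¹) ^ 2 * ((u * ϖ ^ (2 * k) : 𝒪[F]) : F) = ((u : 𝒪[F]) : F) := by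
        push_cast
        field_simp
        ring
      rw [this, hu]
    · refine ⟨((ϖ : F) ^ k)⁻¹, by simp [hϖ0], Or.inr ?_⟩
      have : (((ϖ : F) ^ k)⁻¹) ^ 2 * ((u * ϖ ^ (2 * k + 1) : 𝒪[F]) : F) =
          ((u : 𝒪[F]) : F) * ϖ := by
        push_cast
        field_simp
        ring
      rw [this, map_mul, hu, one_mul]
  rcases le_total (valuation F c) 1 with h | h
  · exact key ⟨c, h⟩ fun h0 => hc (congrArg Subtype.val h0)
  -- A non-integral c lies in the same square class as its integral inverse.
  · have h' : valuation F c⁻¹ ≤ 1 := by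
      rw [map_inv₀]
      exact inv_le_one_of_one_le₀ h
    obtain ⟨a, ha, hac⟩ := key ⟨c⁻¹, h'⟩ fun h0 => inv_ne_zero hc (congrArg Subtype.val h0)
    refine ⟨a / c, div_ne_zero ha hc, ?_⟩
    have : (a / c) ^ 2 * c = a ^ 2 * c⁻¹ := by field_simp
    rwa [this]

/-- In residue characteristic 2, squaring is surjective on the finite residue field. -/
theorem exists_valuation_sq_sub_lt_one (h2 : valuation F (2 : F) < 1) {c : F}
    (hc : valuation F c ≤ 1) : ∃ a : F, valuation F a ≤ 1 ∧ valuation F (a ^ 2 - c) < 1 := by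
  have hchar : (2 : 𝓀[F]) = 0 := by
    have h : IsLocalRing.residue 𝒪[F] 2 = 0 := by
      rw [IsLocalRing.residue_eq_zero_iff, mem_maximalIdeal_iff_valuation_lt_one]
      exact h2
    rwa [map_ofNat] at h
  have hring : ringChar 𝓀[F] = 2 :=
    CharP.ringChar_of_prime_eq_zero Nat.prime_two (by exact_mod_cast hchar)
  obtain ⟨b, hb⟩ := FiniteField.isSquare_of_char_two hring (IsLocalRing.residue 𝒪[F] ⟨c, hc⟩)
  obtain ⟨a, rfl⟩ := IsLocalRing.residue_surjective b
  refine ⟨a, a.2, ?_⟩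
  rw [← map_mul, eq_comm, residue_eq_iff_valuation_sub_lt_one] at hb
  simpa [pow_two] using hb

/-- In odd residue characteristic, a nondegenerate binary quadratic form over the finite residue
field represents everything. -/
theorem exists_valuation_sq_add_mul_sq_sub_lt_one (h2 : valuation F (2 : F) = 1) {c d : F}
    (hc : valuation F c ≤ 1) (hd : valuation F d = 1) :
    ∃ a b : F, valuation F a ≤ 1 ∧ valuation F b ≤ 1 ∧
      valuation F (a ^ 2 + d * b ^ 2 - c) < 1 := by
  let _ : Fintype 𝓀[F] := Fintype.ofFinite _
  have hchar : (2 : 𝓀[F]) ≠ 0 := by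
    intro h
    rw [← map_ofNat (IsLocalRing.residue 𝒪[F]), IsLocalRing.residue_eq_zero_iff,
      mem_maximalIdeal_iff_valuation_lt_one] at h
    exact h.ne h2
  have hring : ringChar 𝓀[F] ≠ 2 := by
    intro h
    apply hchar
    have := ringChar.Nat.cast_ringChar (R := 𝓀[F])
    rw [h] at this
    exact_mod_cast this
  set c' := IsLocalRing.residue 𝒪[F] ⟨c, hc⟩ with hc'
  set d' := IsLocalRing.residue 𝒪[F] ⟨d, hd.le⟩ with hd'
  have hd0 : d' ≠ 0 := by
    rw [hd', ne_eq, IsLocalRing.residue_eq_zero_iff, mem_maximalIdeal_iff_valuation_lt_one]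
    exact fun h => h.ne hd
  obtain ⟨a, b, hab⟩ := FiniteField.exists_root_sum_quadratic
    (f := (Polynomial.X ^ 2 - Polynomial.C c' : Polynomial 𝓀[F]))
    (g := Polynomial.C d' * Polynomial.X ^ 2)
    (Polynomial.degree_X_pow_sub_C (by norm_num) _)
    (Polynomial.degree_C_mul_X_pow 2 hd0) (FiniteField.odd_card_of_char_ne_two hring)
  obtain ⟨a, rfl⟩ := IsLocalRing.residue_surjective a
  obtain ⟨b, rfl⟩ := IsLocalRing.residue_surjective b
  refine ⟨a, b, a.2, b.2, ?_⟩
  have h : IsLocalRing.residue 𝒪[F] (a ^ 2 + ⟨d, hd.le⟩ * b ^ 2) =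
      IsLocalRing.residue 𝒪[F] ⟨c, hc⟩ := by
    simp only [Polynomial.eval_sub, Polynomial.eval_pow, Polynomial.eval_X, Polynomial.eval_C,
      Polynomial.eval_mul] at hab
    rw [map_add, map_pow, map_mul, map_pow, ← hc', ← hd']
    linear_combination hab
  rw [residue_eq_iff_valuation_sub_lt_one] at h
  simpa using h

theorem ideal_eq_of_sq_eq_sq {R : Type*} [CommRing R] [IsDedekindDomain R]
    {I J : Ideal R} (h : I ^ 2 = J ^ 2) : I = J :=
  pow_left_injective two_ne_zero h

/-- Every square class has a representative that is a unit or a uniformizer. -/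
theorem maximalIdeal_le_squareClassIdeal (δ : SquareClasses F) :
    𝓂[F] ≤ squareClassIdeal δ := by
  obtain ⟨u, rfl⟩ := QuotientGroup.mk_surjective δ
  obtain ⟨ϖ, hϖ⟩ := IsDiscreteValuationRing.exists_irreducible 𝒪[F]
  obtain ⟨a, ha, hv⟩ := exists_sq_mul_valuation_eq hϖ u.ne_zero
  have hϖ1 : valuation F (ϖ : F) ≤ 1 := ϖ.2
  have hle : valuation F (a ^ 2 * u) ≤ 1 := by
    rcases hv with h | h <;> rw [h]
    exact hϖ1
  have hge : valuation F (ϖ : F) ≤ valuation F (a ^ 2 * u) := by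
    rcases hv with h | h <;> rw [h]
    exact hϖ1
  have hmem : (⟨a ^ 2 * u, hle⟩ : 𝒪[F]) ∈
      squareClassIdeal (QuotientGroup.mk u : SquareClasses F) := by
    apply Ideal.subset_span
    refine ⟨Units.mk0 a ha ^ 2 * u, ?_, by simp⟩
    rw [eq_comm, QuotientGroup.eq]
    refine ⟨Units.mk0 a ha, ?_⟩
    simp [mul_comm]
  rw [hϖ.maximalIdeal_eq, Ideal.span_singleton_le_iff_mem]
  exact Ideal.mem_of_dvd _ ((Valuation.integer.integers (valuation F)).dvd_of_le hge) hmem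

end LocalField

/-! ### The valuation of `H` and its ring as the unique maximal order -/

section QuaternionValuation

open ValuativeRel

variable {F : Type*} [Field F] [ValuativeRel F] [TopologicalSpace F]
  [IsNonarchimedeanLocalField F] {H : Type*} [DivisionRing H] [Algebra F H]
  [Algebra.IsCentral F H] (h2 : (2 : F) ≠ 0) (hdim : finrank F H = 4)

include h2 hdim in
/-- If `n` is small compared to `t ^ 2` then `X ^ 2 - t X + n` is reducible over `F` by Hensel's
lemma, so the reduced norm dominates the square of the reduced trace. -/
theorem valuation_quatTrd_sq_le (x : H) :
    valuation F (quatTrd F x) ^ 2 ≤ valuation F (quatNrd F x) := by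
  by_contra! hlt
  set t := quatTrd F x with ht
  set n := quatNrd F x with hn
  have ht0 : t ≠ 0 := by
    intro h
    rw [h, map_zero, zero_pow two_ne_zero] at hlt
    exact not_lt_zero hlt
  have hc : valuation F (n / t ^ 2) < 1 := by
    rw [map_div₀, map_pow]
    exact (div_lt_one₀ (pow_pos (zero_lt_iff.2 (by simpa using ht0)) 2)).2 hlt
  obtain ⟨r, hr⟩ := exists_sq_sub_self_add_eq_zero hc
  have hs : t * r * (t - t * r) = n := by
    field_simp at hr
    linear_combination -hr
  -- The elements tr and t - tr are the two roots in `F` of the quadratic polynomial of x.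
  have hprod : (x - algebraMap F H (t * r)) * (x - algebraMap F H (t - t * r)) = 0 := by
    have hxx := mul_self_eq_quatTrd_smul_sub h2 hdim x
    rw [← ht, ← hn, ← hs, Algebra.smul_def] at hxx
    rw [sub_mul, mul_sub, mul_sub, hxx, ← Algebra.commutes (t - t * r) x]
    simp only [map_sub, map_mul]
    noncomm_ring
  obtain ⟨c, rfl⟩ : ∃ c, x = algebraMap F H c := by
    rcases mul_eq_zero.1 hprod with h | h
    · exact ⟨_, sub_eq_zero.1 h⟩
    · exact ⟨_, sub_eq_zero.1 h⟩
  -- For a scalar c the assumed inequality reads |c|² < |2|²|c|².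
  rw [ht, hn, quatTrd_algebraMap h2 hdim, quatNrd_algebraMap h2 hdim, map_mul, map_pow,
    mul_pow] at hlt
  have h2le : valuation F (2 : F) ≤ 1 := (2 : 𝒪[F]).2
  exact hlt.not_ge (mul_le_of_le_one_left' (pow_le_one' h2le 2))

/-- The valuation of the reduced norm is a valuation of the quaternion division algebra. -/
noncomputable def quatValuation : Valuation H (ValueGroupWithZero F) where
  toFun x := valuation F (quatNrd F x)
  map_zero' := by rw [(quatNrd_eq_zero h2 hdim).2 rfl, map_zero]
  map_one' := by
    rw [← map_one (algebraMap F H), quatNrd_algebraMap h2 hdim, one_pow, map_one]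
  map_mul' x y := by rw [quatNrd_mul h2 hdim, map_mul]
  map_add_le_max' := by
    have key : ∀ x y : H, valuation F (quatNrd F x) ≤ valuation F (quatNrd F y) →
        valuation F (quatNrd F (x + y)) ≤ valuation F (quatNrd F y) := by
      intro x y hxy
      by_cases hy : y = 0
      · subst hy
        rw [(quatNrd_eq_zero h2 hdim).2 rfl, map_zero, le_zero_iff, map_eq_zero,
          quatNrd_eq_zero h2 hdim] at hxy
        rw [hxy, add_zero]
      · have hz : valuation F (quatNrd F (x * y⁻¹)) ≤ 1 := by
          have h : valuation F (quatNrd F y) ≠ 0 := by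
            rwa [ne_eq, map_eq_zero, quatNrd_eq_zero h2 hdim]
          rw [← mul_le_mul_iff_left₀ (zero_lt_iff.2 h), ← map_mul, ← quatNrd_mul h2 hdim,
            mul_assoc, inv_mul_cancel₀ hy, mul_one, one_mul]
          exact hxy
        have ht : valuation F (quatTrd F (x * y⁻¹)) ≤ 1 :=
          (pow_le_one_iff two_ne_zero).1 ((valuation_quatTrd_sq_le h2 hdim _).trans hz)
        -- Dividing by y leaves nrd(z + 1) = nrd z + trd z + 1 with z = xy⁻¹, where all three terms
        -- are integral.
        have hxy' : x + y = (x * y⁻¹ + algebraMap F H 1) * y := by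
          rw [map_one, add_mul, mul_assoc, inv_mul_cancel₀ hy, mul_one, one_mul]
        rw [hxy', quatNrd_mul h2 hdim, map_mul, quatNrd_add_algebraMap h2 hdim, one_pow, one_mul]
        refine mul_le_of_le_one_left' ?_
        exact Valuation.map_add_le _ (Valuation.map_add_le _ hz ht) (map_one _).le
    intro x y
    rcases le_total (valuation F (quatNrd F x)) (valuation F (quatNrd F y)) with h | h
    · exact (key x y h).trans (le_max_right _ _)
    · rw [add_comm]
      exact (key y x h).trans (le_max_left _ _)

theorem quatValuation_apply (x : H) :
    quatValuation h2 hdim x = valuation F (quatNrd F x) := rfl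

theorem quatValuation_algebraMap (c : F) :
    quatValuation h2 hdim (algebraMap F H c) = valuation F c ^ 2 := by
  rw [quatValuation_apply, quatNrd_algebraMap h2 hdim, map_pow]

theorem quatValuation_smul (c : F) (x : H) :
    quatValuation h2 hdim (c • x) = valuation F c ^ 2 * quatValuation h2 hdim x := by
  rw [Algebra.smul_def, map_mul, quatValuation_algebraMap]

/-- The valuation ring of a quaternion division algebra over a local field. -/
noncomputable def quatIntegers : Subalgebra 𝒪[F] H where
  __ := (quatValuation h2 hdim).integer
  algebraMap_mem' r := by
    change quatValuation h2 hdim (algebraMap F H r) ≤ 1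
    rw [quatValuation_algebraMap]
    exact pow_le_one' r.2 2

theorem mem_quatIntegers {x : H} :
    x ∈ quatIntegers h2 hdim ↔ quatValuation h2 hdim x ≤ 1 := Iff.rfl

theorem valuation_quatTrd_le_one {x : H} (hx : x ∈ quatIntegers h2 hdim) :
    valuation F (quatTrd F x) ≤ 1 :=
  (pow_le_one_iff two_ne_zero).1 ((valuation_quatTrd_sq_le h2 hdim _).trans hx)

theorem valuation_quatTrd_lt_one {x : H} (hx : quatValuation h2 hdim x < 1) :
    valuation F (quatTrd F x) < 1 :=
  (pow_lt_one_iff two_ne_zero).1 ((valuation_quatTrd_sq_le h2 hdim _).trans_lt hx)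

theorem exists_smul_mem_quatIntegers (x : H) :
    ∃ a : F, a ≠ 0 ∧ a • x ∈ quatIntegers h2 hdim := by
  by_cases hx : quatValuation h2 hdim x ≤ 1
  · exact ⟨1, one_ne_zero, by rwa [one_smul]⟩
  · rw [quatValuation_apply, not_le] at hx
    have hn0 : quatNrd F x ≠ 0 := by
      intro h
      rw [h, map_zero] at hx
      exact not_lt_zero hx
    -- The norm scales by the square of the factor, so the scaled element has norm nrd(x)⁻¹.
    refine ⟨(quatNrd F x)⁻¹, inv_ne_zero hn0, ?_⟩
    rw [mem_quatIntegers, quatValuation_smul, quatValuation_apply, map_inv₀, pow_two, mul_assoc,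
      inv_mul_cancel₀ (by simpa using hn0), mul_one]
    exact inv_le_one_of_one_le₀ hx.le

theorem isOrder_quatIntegers : IsOrder (quatIntegers h2 hdim) := by
  have hfin : FiniteDimensional F H := FiniteDimensional.of_finrank_pos (by omega)
  constructor
  · let b₀ := Module.finBasis F H
    choose a ha0 ha using fun i => exists_smul_mem_quatIntegers h2 hdim (b₀ i)
    let b := b₀.unitsSMul fun i => Units.mk0 (a i) (ha0 i)
    have hb (i) : b i ∈ quatIntegers h2 hdim := by
      rw [Basis.unitsSMul_apply]
      exact ha i
    -- Products of integral elements have integral trace, so the ring lies in the trace dual of the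
    -- lattice spanned by b. That dual is finitely generated over a noetherian ring.
    have hle : Subalgebra.toSubmodule (quatIntegers h2 hdim) ≤
        (quatTrdForm F H).dualSubmodule (Submodule.span 𝒪[F] (Set.range b)) := by
      intro x hx y hy
      have hy' : y ∈ Subalgebra.toSubmodule (quatIntegers h2 hdim) := by
        refine Submodule.span_le.2 ?_ hy
        rintro _ ⟨i, rfl⟩
        exact hb i
      rw [Submodule.mem_one]
      exact ⟨⟨_, valuation_quatTrd_le_one h2 hdim (mul_mem hx hy')⟩, rfl⟩
    rw [LinearMap.BilinForm.dualSubmodule_span_of_basis _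
      (quatTrdForm_nondegenerate h2 hdim)] at hle
    exact Submodule.FG.of_le (Submodule.fg_span (Set.finite_range _)) hle
  · rw [eq_top_iff]
    intro x _
    obtain ⟨a, ha0, ha⟩ := exists_smul_mem_quatIntegers h2 hdim x
    rw [← inv_smul_smul₀ ha0 x]
    exact Submodule.smul_mem _ _ (Submodule.subset_span ha)

/-- Every order consists of elements of integral reduced norm. -/
theorem IsOrder.le_quatIntegers {O : Subalgebra 𝒪[F] H} (hO : IsOrder O) :
    O ≤ quatIntegers h2 hdim := by
  obtain ⟨S, hS⟩ := hO.fg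
  obtain ⟨M, hM⟩ := (S.image (quatValuation h2 hdim)).exists_le
  have hbound : ∀ x ∈ O, quatValuation h2 hdim x ≤ M := by
    intro x hx
    replace hx : x ∈ Submodule.span 𝒪[F] (S : Set H) := hS ▸ hx
    induction hx using Submodule.span_induction with
    | mem y hy => exact hM _ (Finset.mem_image_of_mem _ hy)
    | zero => rw [map_zero]; exact zero_le
    | add y z _ _ hy hz => exact Valuation.map_add_le _ hy hz
    | smul a y _ hy =>
      change quatValuation h2 hdim ((a : F) • y) ≤ M
      rw [quatValuation_smul]
      exact (mul_le_of_le_one_left' (pow_le_one' a.2 2)).trans hy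
  intro x hx
  by_contra hlt
  rw [mem_quatIntegers, not_le] at hlt
  -- Powers of x stay in `O` and are bounded by M, yet M is at most the n-th power of the value of
  -- x, which exceeds 1.
  obtain ⟨n, hn⟩ := MulArchimedean.arch M hlt
  have h := (hbound _ (pow_mem hx (n + 1))).trans hn
  rw [map_pow, pow_le_pow_iff_right₀ hlt] at h
  omega

theorem isMaximalOrder_iff {O : Subalgebra 𝒪[F] H} :
    IsMaximalOrder O ↔ O = quatIntegers h2 hdim := by
  constructor
  · intro h
    exact h.eq_of_le (isOrder_quatIntegers h2 hdim) (h.prop.le_quatIntegers h2 hdim)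
  · rintro rfl
    exact ⟨isOrder_quatIntegers h2 hdim, fun O hO _ => hO.le_quatIntegers h2 hdim⟩

theorem IsOrthogonalInvolution.isInvolutionOrder_quatIntegers {σ : H →ₗ[F] H}
    (hσ : IsOrthogonalInvolution σ) : IsInvolutionOrder σ (quatIntegers h2 hdim) := by
  have hmem : ∀ x ∈ quatIntegers h2 hdim, σ x ∈ quatIntegers h2 hdim := by
    intro x hx
    rwa [mem_quatIntegers, quatValuation_apply, hσ.quatNrd_apply h2 hdim]
  refine ⟨isOrder_quatIntegers h2 hdim, Set.Subset.antisymm ?_ ?_⟩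
  · rintro _ ⟨x, hx, rfl⟩
    exact hmem x hx
  · intro x hx
    exact ⟨σ x, hmem x hx, hσ.involutive x⟩

theorem IsOrthogonalInvolution.isMaximalInvolutionOrder_iff {σ : H →ₗ[F] H}
    (hσ : IsOrthogonalInvolution σ) {O : Subalgebra 𝒪[F] H} :
    IsMaximalInvolutionOrder σ O ↔ O = quatIntegers h2 hdim := by
  have hO := hσ.isInvolutionOrder_quatIntegers h2 hdim
  constructor
  · intro h
    exact h.eq_of_le hO (h.prop.1.le_quatIntegers h2 hdim)
  · rintro rfl
    exact ⟨hO, fun O hO _ => hO.1.le_quatIntegers h2 hdim⟩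

end QuaternionValuation

/-! ### An unramified element and a uniformizer -/

section QuaternionGenerators

open ValuativeRel

variable {F : Type*} [Field F] [ValuativeRel F] [TopologicalSpace F]
  [IsNonarchimedeanLocalField F] {H : Type*} [DivisionRing H] [Algebra F H]
  [Algebra.IsCentral F H] (h2 : (2 : F) ≠ 0) (hdim : finrank F H = 4)

/-- If every residue comes from `F`, then approximating once by 1 and once by an element y of value
|ϖ| leaves a remainder in ϖ times the ring, and Nakayama's lemma applies. -/
theorem exists_quatIntegers_le_span_pair {ϖ : 𝒪[F]} (hϖ : Irreducible ϖ)
    (hres : ∀ x ∈ quatIntegers h2 hdim, ∃ a : 𝒪[F],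
      quatValuation h2 hdim (x - algebraMap 𝒪[F] H a) < 1) :
    ∃ y : H, Subalgebra.toSubmodule (quatIntegers h2 hdim) ≤ Submodule.span 𝒪[F] {1, y} := by
  have hϖ0 : (ϖ : F) ≠ 0 := fun h => hϖ.ne_zero (Subtype.ext h)
  have hlt {x : H} : quatValuation h2 hdim x < 1 ↔
      quatValuation h2 hdim x ≤ valuation F (ϖ : F) :=
    valuation_lt_one_iff_le_irreducible hϖ
  have hdiv {x : H} (hx : quatValuation h2 hdim x ≤ valuation F (ϖ : F) ^ 2) :
      ∃ z ∈ quatIntegers h2 hdim, x = ϖ • z := by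
    refine ⟨(ϖ : F)⁻¹ • x, ?_, ?_⟩
    · rw [mem_quatIntegers, quatValuation_smul, map_inv₀, inv_pow]
      exact inv_mul_le_one_of_le₀ hx (by simp)
    · change x = (ϖ : F) • (ϖ : F)⁻¹ • x
      rw [smul_inv_smul₀ hϖ0]
  obtain ⟨y, hy⟩ : ∃ y : H, ∀ x : H, quatValuation h2 hdim x < 1 →
      ∃ b : 𝒪[F], quatValuation h2 hdim (x - b • y) ≤ valuation F (ϖ : F) ^ 2 := by
    by_cases hex : ∃ y : H, quatValuation h2 hdim y = valuation F (ϖ : F)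
    · obtain ⟨y, hy⟩ := hex
      have hy0 : y ≠ 0 := by
        rintro rfl
        rw [map_zero, eq_comm, map_eq_zero] at hy
        exact hϖ0 hy
      refine ⟨y, fun x hx => ?_⟩
      obtain ⟨b, hb⟩ := hres (x * y⁻¹) (by
        rw [mem_quatIntegers, map_mul, map_inv₀, hy]
        exact mul_inv_le_one_of_le₀ (hlt.1 hx) zero_le)
      refine ⟨b, ?_⟩
      have : x - b • y = (x * y⁻¹ - algebraMap 𝒪[F] H b) * y := by
        rw [sub_mul, mul_assoc, inv_mul_cancel₀ hy0, mul_one, Algebra.smul_def]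
      rw [this, map_mul, hy, pow_two]
      exact mul_le_mul_left (hlt.1 hb) _
    -- Without elements of value |ϖ|, every value below 1 is already at most |ϖ|², so y = 0
    -- suffices.
    · push Not at hex
      refine ⟨0, fun x hx => ⟨0, ?_⟩⟩
      rw [smul_zero, sub_zero]
      have h : valuation F (quatNrd F x / ϖ) < 1 := by
        rw [map_div₀]
        exact (div_lt_one₀ (zero_lt_iff.2 (by simpa using hϖ0))).2
          (lt_of_le_of_ne (hlt.1 hx) (hex x))
      rw [valuation_lt_one_iff_le_irreducible hϖ, map_div₀,
        div_le_iff₀ (zero_lt_iff.2 (by simpa using hϖ0)), ← pow_two] at h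
      exact h
  refine ⟨y, Submodule.le_of_le_smul_of_le_jacobson_bot (I := 𝓂[F])
    (isOrder_quatIntegers h2 hdim).fg (IsLocalRing.maximalIdeal_le_jacobson _) ?_⟩
  intro x hx
  obtain ⟨a, ha⟩ := hres x hx
  obtain ⟨b, hb⟩ := hy _ ha
  obtain ⟨z, hz, hxz⟩ := hdiv hb
  have hsum : x = (a • (1 : H) + b • y) + ϖ • z := by
    rw [← hxz, ← Algebra.algebraMap_eq_smul_one]
    abel
  rw [hsum]
  refine Submodule.add_mem_sup ?_ (Submodule.smul_mem_smul ?_ hz)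
  · exact Submodule.mem_span_pair.2 ⟨a, b, rfl⟩
  · rw [hϖ.maximalIdeal_eq]
    exact Ideal.mem_span_singleton_self ϖ

/-- The residue ring of the valuation ring of `H` is bigger than the residue field of `F`. -/
theorem exists_mem_quatIntegers_sub_not_lt_one :
    ∃ x ∈ quatIntegers h2 hdim, ∀ a : 𝒪[F],
      ¬ quatValuation h2 hdim (x - algebraMap 𝒪[F] H a) < 1 := by
  by_contra! hres
  obtain ⟨ϖ, hϖ⟩ := IsDiscreteValuationRing.exists_irreducible 𝒪[F]
  obtain ⟨y, hy⟩ := exists_quatIntegers_le_span_pair h2 hdim hϖ hres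
  have htop : Submodule.span F (Set.range ![1, y]) = ⊤ := by
    rw [eq_top_iff, ← (isOrder_quatIntegers h2 hdim).span_eq_top, Submodule.span_le]
    intro x hx
    obtain ⟨a, b, rfl⟩ := Submodule.mem_span_pair.1 (hy hx)
    rw [Matrix.range_cons, Matrix.range_cons, Matrix.range_empty, Set.union_empty,
      Set.singleton_union]
    exact Submodule.mem_span_pair.2 ⟨a, b, rfl⟩
  have h := finrank_range_le_card (R := F) ![1, y]
  rw [Set.finrank, htop, finrank_top, hdim, Fintype.card_fin] at h
  omega

/-- `H` contains an element which generates an unramified quadratic extension of `F`. -/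
theorem exists_valuation_quatTrd_sq_sub_eq_one :
    ∃ u ∈ quatIntegers h2 hdim,
      valuation F (quatTrd F u ^ 2 - 4 * quatNrd F u) = 1 := by
  obtain ⟨u, hu, hres⟩ := exists_mem_quatIntegers_sub_not_lt_one h2 hdim
  refine ⟨u, hu, ?_⟩
  set t := quatTrd F u with ht
  set n := quatNrd F u with hn
  have ht1 : valuation F t ≤ 1 := valuation_quatTrd_le_one h2 hdim hu
  have hn1 : valuation F n ≤ 1 := hu
  have h21 : valuation F (2 : F) ≤ 1 := (2 : 𝒪[F]).2
  have h4 : valuation F (4 : F) ≤ 1 := (4 : 𝒪[F]).2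
  have hle : valuation F (t ^ 2 - 4 * n) ≤ 1 := by
    refine Valuation.map_sub_le (v := valuation F) ?_ ?_
    · rw [map_pow]
      exact pow_le_one' ht1 2
    · rw [map_mul]
      exact mul_le_one' h4 hn1
  refine hle.eq_of_not_lt fun hlt => ?_
  have hres' (a : F) (ha : valuation F a ≤ 1) : ¬ valuation F (n - a * t + a ^ 2) < 1 := by
    have h := hres ⟨a, ha⟩
    have h' : u - algebraMap 𝒪[F] H ⟨a, ha⟩ = u + algebraMap F H (-a) := by
      rw [map_neg, ← sub_eq_add_neg]
      rfl
    rw [h', quatValuation_apply, quatNrd_add_algebraMap h2 hdim] at h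
    convert h using 3
    ring
  -- If the discriminant is not a unit, then X² - tX + n has a double root a modulo 𝔭, and nrd(u -
  -- a) = n - at + a² is not a unit. In residue characteristic 2 the trace t vanishes modulo 𝔭 and a
  -- is a square root of n; otherwise a = t/2.
  rcases h21.lt_or_eq with h2lt | h2eq
  · have htlt : valuation F t < 1 := by
      rw [← pow_lt_one_iff two_ne_zero, ← map_pow, ← sub_add_cancel (t ^ 2) (4 * n)]
      refine Valuation.map_add_lt _ hlt ?_
      have : (4 : F) * n = 2 * (2 * n) := by ring
      rw [this, map_mul, map_mul]
      exact mul_lt_one_of_lt_of_le h2lt (mul_le_one' h21 hn1)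
    obtain ⟨a, ha, han⟩ := exists_valuation_sq_sub_lt_one h2lt hn1
    apply hres' a ha
    have : n - a * t + a ^ 2 = (a ^ 2 - n) + (2 * n - a * t) := by ring
    rw [this]
    refine Valuation.map_add_lt _ han (Valuation.map_sub_lt _ ?_ ?_)
    · rw [map_mul]
      exact mul_lt_one_of_lt_of_le h2lt hn1
    · rw [map_mul]
      exact mul_lt_one_of_nonneg_of_lt_one_right ha zero_le htlt
  · apply hres' (t / 2) (by rwa [map_div₀, h2eq, div_one])
    have : n - t / 2 * t + (t / 2) ^ 2 = -(t ^ 2 - 4 * n) / (2 * 2) := by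
      field_simp
      ring
    rwa [this, map_div₀, Valuation.map_neg, map_mul, h2eq, mul_one, div_one]

/-- An element which conjugates an unramified quadratic extension is not a unit: otherwise some
`x = a + b z + j` lies in the maximal ideal, where `z = 2 u - trd u`, but `u x - x u = z j` is a
unit. -/
theorem quatValuation_ne_one_of_conj {u j : H}
    (hΔ1 : valuation F (quatTrd F u ^ 2 - 4 * quatNrd F u) = 1) (hu : u ∈ quatIntegers h2 hdim)
    (huj : j * u = quatConj F u * j) : quatValuation h2 hdim j ≠ 1 := by
  intro hj1
  set Δ := quatTrd F u ^ 2 - 4 * quatNrd F u with hΔdef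
  have hΔ : Δ ≠ 0 := by
    intro h
    rw [h, map_zero] at hΔ1
    exact zero_ne_one hΔ1
  set z := (2 : F) • u - algebraMap F H (quatTrd F u) with hz
  have hnz : quatNrd F z = -Δ := quatNrd_two_smul_sub h2 hdim u
  have htz : quatTrd F z = 0 := quatTrd_two_smul_sub h2 hdim u
  have huz : u * z = z * u := by
    rw [hz, mul_sub, sub_mul, mul_smul_comm, smul_mul_assoc, Algebra.commutes]
  have htj : quatTrd F j = 0 := by
    simpa using quatTrd_mul_eq_zero_of_conj h2 hdim huj hΔ (x := 1) (by simp)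
  have htzj : quatTrd F (z * j) = 0 := quatTrd_mul_eq_zero_of_conj h2 hdim huj hΔ huz
  have hnorm (a b : F) :
      quatNrd F (b • z + j + algebraMap F H a) = a ^ 2 + -Δ * b ^ 2 - -quatNrd F j := by
    rw [quatNrd_add_algebraMap h2 hdim, quatNrd_add h2 hdim, quatNrd_smul, quatTrd_add,
      quatTrd_smul, smul_mul_assoc, quatTrd_smul, htzj, htz, htj, hnz]
    ring
  obtain ⟨a, b, hab⟩ : ∃ a b : F, quatValuation h2 hdim (b • z + j + algebraMap F H a) < 1 := by
    have hc : valuation F (-quatNrd F j) ≤ 1 := by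
      rw [Valuation.map_neg]
      exact hj1.le
    -- The form a² - Δb² has to represent -nrd j modulo 𝔭. In residue characteristic 2 the square a²
    -- alone does, so b = 0.
    rcases (show valuation F (2 : F) ≤ 1 from (2 : 𝒪[F]).2).lt_or_eq with h | h
    · obtain ⟨a, -, ha⟩ := exists_valuation_sq_sub_lt_one h hc
      refine ⟨a, 0, ?_⟩
      rw [quatValuation_apply, hnorm]
      simpa using ha
    · obtain ⟨a, b, -, -, hab⟩ := exists_valuation_sq_add_mul_sq_sub_lt_one h hc
        (show valuation F (-Δ) = 1 by rw [Valuation.map_neg, hΔ1])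
      refine ⟨a, b, ?_⟩
      rwa [quatValuation_apply, hnorm]
  set x := b • z + j + algebraMap F H a with hx
  have hcomm : u * x - x * u = z * j := by
    have h1 : u * x - x * u = u * j - j * u := by
      rw [hx, mul_add, mul_add, add_mul, add_mul, mul_smul_comm, smul_mul_assoc, huz,
        Algebra.commutes]
      abel
    rw [h1, huj, quatConj, hz, sub_mul, sub_mul, smul_mul_assoc, two_smul]
    abel
  have hlt : quatValuation h2 hdim (u * x - x * u) < 1 := by
    refine Valuation.map_sub_lt _ ?_ ?_ <;> rw [map_mul]
    · exact mul_lt_one_of_nonneg_of_lt_one_right hu zero_le hab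
    · exact mul_lt_one_of_lt_of_le hab hu
  rw [hcomm, map_mul, hj1, mul_one, quatValuation_apply, hnz, Valuation.map_neg, hΔ1] at hlt
  exact hlt.false

/-- `H` is generated by `u` and `j`, where `u` generates an unramified quadratic extension and `j`
is a uniformizer which acts on it as the nontrivial automorphism. -/
theorem exists_unramified_and_uniformizer {ϖ : 𝒪[F]} (hϖ : Irreducible ϖ) :
    ∃ u j : H, u ∈ quatIntegers h2 hdim ∧
      valuation F (quatTrd F u ^ 2 - 4 * quatNrd F u) = 1 ∧
      j * u = quatConj F u * j ∧ quatValuation h2 hdim j = valuation F (ϖ : F) := by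
  obtain ⟨u, hu, hΔ1⟩ := exists_valuation_quatTrd_sq_sub_eq_one h2 hdim
  obtain ⟨j, hj, huj⟩ := exists_mul_eq_quatConj_mul h2 hdim (u := u) (by
    intro h
    rw [h, map_zero] at hΔ1
    exact zero_ne_one hΔ1)
  -- Scaling j by a keeps the conjugation relation and multiplies nrd j by a².
  obtain ⟨a, ha, hv⟩ := exists_sq_mul_valuation_eq hϖ
    (fun h => hj ((quatNrd_eq_zero h2 hdim).1 h) : quatNrd F j ≠ 0)
  have haj : (a • j) * u = quatConj F u * (a • j) := by
    rw [smul_mul_assoc, huj, mul_smul_comm]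
  rw [← quatNrd_smul, ← quatValuation_apply h2 hdim] at hv
  exact ⟨u, a • j, hu, hΔ1, haj,
    hv.resolve_left (quatValuation_ne_one_of_conj h2 hdim hΔ1 hu haj)⟩

end QuaternionGenerators

/-! ### The trace form in the basis 1, u, j, uj -/

section StandardBasis

variable {F : Type*} [Field F] {H : Type*} [DivisionRing H] [Algebra F H]
  [Algebra.IsCentral F H] (h2 : (2 : F) ≠ 0) (hdim : finrank F H = 4)
  {u j : H} (huj : j * u = quatConj F u * j) (hΔ : quatTrd F u ^ 2 - 4 * quatNrd F u ≠ 0)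

/-- The Gram matrix of the reduced trace form in the basis `1, u, j, u j`, where `u` has reduced
trace `t` and reduced norm `n` and where `j ^ 2 = e`. -/
def quatGram (t n e : F) : Matrix (Fin 4) (Fin 4) F :=
  !![2, t, 0, 0; t, t ^ 2 - 2 * n, 0, 0; 0, 0, 2 * e, t * e; 0, 0, t * e, 2 * n * e]

theorem det_quatGram (t n e : F) :
    (quatGram t n e).det = -(t ^ 2 - 4 * n) ^ 2 * e ^ 2 := by
  simp [quatGram, Matrix.det_succ_row_zero, Fin.sum_univ_succ, Fin.succAbove]
  ring

include h2 hdim hΔ huj in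
theorem quatTrd_mul_eq_quatGram (i k : Fin 4) :
    quatTrd F (![1, u, j, u * j] i * ![1, u, j, u * j] k) =
      quatGram (quatTrd F u) (quatNrd F u) (-quatNrd F j) i k := by
  have huu := mul_self_eq_quatTrd_smul_sub h2 hdim u
  have hjj := mul_self_eq_of_conj h2 hdim huj hΔ
  have h1 : quatTrd F (1 : H) = 2 := quatTrd_one h2 hdim
  have htuu : quatTrd F (u * u) = quatTrd F u ^ 2 - 2 * quatNrd F u := by
    rw [huu, quatTrd_sub, quatTrd_smul, quatTrd_algebraMap h2 hdim]
    ring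
  have htj : quatTrd F j = 0 := by
    simpa using quatTrd_mul_eq_zero_of_conj h2 hdim huj hΔ (x := 1) (by simp)
  have htuj : quatTrd F (u * j) = 0 := quatTrd_mul_eq_zero_of_conj h2 hdim huj hΔ rfl
  have htuuj : quatTrd F (u * (u * j)) = 0 := by
    rw [← mul_assoc]
    exact quatTrd_mul_eq_zero_of_conj h2 hdim huj hΔ (mul_assoc _ _ _).symm
  have htjj : quatTrd F (j * j) = 2 * -quatNrd F j := by
    rw [hjj, quatTrd_algebraMap h2 hdim]
  have htujj : quatTrd F (u * j * j) = quatTrd F u * -quatNrd F j := by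
    rw [mul_assoc, hjj, ← Algebra.commutes, ← Algebra.smul_def, quatTrd_smul, mul_comm]
  have htujuj : quatTrd F (u * j * (u * j)) = 2 * quatNrd F u * -quatNrd F j := by
    have : u * j * (u * j) = algebraMap F H (quatNrd F u * -quatNrd F j) := by
      have hconj : u * quatConj F u = algebraMap F H (quatNrd F u) := by
        rw [algebraMap_quatNrd h2 hdim, quatConj, mul_sub, sub_mul, Algebra.commutes]
      rw [mul_assoc, ← mul_assoc j, huj, mul_assoc, hjj, ← mul_assoc, hconj, map_mul]
    rw [this, quatTrd_algebraMap h2 hdim]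
    ring
  have htju : quatTrd F (j * u) = 0 := by rw [quatTrd_mul_comm, htuj]
  have htjuj : quatTrd F (j * (u * j)) = quatTrd F u * -quatNrd F j := by
    rw [quatTrd_mul_comm, htujj]
  have htuju : quatTrd F (u * j * u) = 0 := by rw [quatTrd_mul_comm, htuuj]
  fin_cases i <;> fin_cases k <;>
    simp [quatGram, h1, htuu, htj, htuj, htuuj, htjj, htujj, htujuj, htju, htjuj, htuju]

include h2 hdim hΔ huj in
theorem quatTrd_sum_smul_mul (c : Fin 4 → F) (k : Fin 4) :
    quatTrd F ((∑ i, c i • ![1, u, j, u * j] i) * ![1, u, j, u * j] k) =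
      ∑ i, c i * quatGram (quatTrd F u) (quatNrd F u) (-quatNrd F j) i k := by
  rw [Finset.sum_mul, ← quatTrdLinear_apply, map_sum]
  refine Finset.sum_congr rfl fun i _ => ?_
  rw [smul_mul_assoc, map_smul, quatTrdLinear_apply,
    quatTrd_mul_eq_quatGram h2 hdim huj hΔ, smul_eq_mul]

-- The Gram determinant is nonzero, as Δ and nrd j are.
include h2 hdim hΔ huj in
theorem linearIndependent_unramified_uniformizer (hj : j ≠ 0) :
    LinearIndependent F ![1, u, j, u * j] := by
  rw [Fintype.linearIndependent_iff]
  intro c hc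
  have hdet : (quatGram (quatTrd F u) (quatNrd F u) (-quatNrd F j)).det ≠ 0 := by
    rw [det_quatGram]
    have : quatNrd F j ≠ 0 := fun h => hj ((quatNrd_eq_zero h2 hdim).1 h)
    simp [hΔ, this]
  have h0 : Matrix.vecMul c (quatGram (quatTrd F u) (quatNrd F u) (-quatNrd F j)) = 0 := by
    ext k
    have h := quatTrd_sum_smul_mul h2 hdim huj hΔ c k
    rw [hc, zero_mul, quatTrd_zero] at h
    exact h.symm
  exact congrFun (Matrix.eq_zero_of_vecMul_eq_zero hdet h0)

end StandardBasis

/-- The matrix algebra has a nonzero nilpotent; a division ring has none. -/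
theorem quatDisc_eq_maximalIdeal (F H : Type*) [Field F] [ValuativeRel F] [DivisionRing H]
    [Algebra F H] : quatDisc F H = 𝓂[F] := by
  rw [quatDisc, if_neg]
  rintro ⟨e⟩
  have h : (!![0, 1; 0, 0] : Matrix (Fin 2) (Fin 2) F) * !![0, 1; 0, 0] = 0 := by
    ext i k
    fin_cases i <;> fin_cases k <;> simp
  have h' := congrArg e.symm h
  rw [map_mul, map_zero, mul_self_eq_zero, map_eq_zero_iff _ e.symm.injective] at h'
  exact one_ne_zero (congrFun (congrFun h' 0) 1)

/-! ### Computation of the discriminant -/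

section Discriminant

open ValuativeRel

/-- A symmetric integral linear system of unit determinant has integral solutions. -/
theorem valuation_le_one_of_det_eq_one {F : Type*} [Field F] [ValuativeRel F] {p q r a b : F}
    (hΔ : valuation F (p * r - q ^ 2) = 1)
    (hp : valuation F p ≤ 1) (hq : valuation F q ≤ 1) (hr : valuation F r ≤ 1)
    (h₁ : valuation F (p * a + q * b) ≤ 1) (h₂ : valuation F (q * a + r * b) ≤ 1) :
    valuation F a ≤ 1 ∧ valuation F b ≤ 1 := by
  constructor
  · rw [← one_mul (valuation F a)]
    nth_rw 1 [← hΔ]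
    rw [← map_mul]
    have : (p * r - q ^ 2) * a = r * (p * a + q * b) - q * (q * a + r * b) := by ring
    rw [this]
    refine Valuation.map_sub_le (v := valuation F) ?_ ?_ <;> rw [map_mul]
    · exact mul_le_one' hr h₁
    · exact mul_le_one' hq h₂
  · rw [← one_mul (valuation F b)]
    nth_rw 1 [← hΔ]
    rw [← map_mul]
    have : (p * r - q ^ 2) * b = p * (q * a + r * b) - q * (p * a + q * b) := by ring
    rw [this]
    refine Valuation.map_sub_le (v := valuation F) ?_ ?_ <;> rw [map_mul]
    · exact mul_le_one' hp h₂
    · exact mul_le_one' hq h₁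

variable {F : Type*} [Field F] [ValuativeRel F] [TopologicalSpace F]
  [IsNonarchimedeanLocalField F] {H : Type*} [DivisionRing H] [Algebra F H]
  [Algebra.IsCentral F H] (h2 : (2 : F) ≠ 0) (hdim : finrank F H = 4)

variable {ϖ : 𝒪[F]} (hϖ : Irreducible ϖ) {u j : H} (hu : u ∈ quatIntegers h2 hdim)
  (hΔ : valuation F (quatTrd F u ^ 2 - 4 * quatNrd F u) = 1)
  (huj : j * u = quatConj F u * j) (hj : quatValuation h2 hdim j = valuation F (ϖ : F))

include hϖ hu hΔ huj hj in
/-- The elements `1, u, j, u j` generate the valuation ring over `𝔬`. -/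
theorem valuation_coord_le_one {c : Fin 4 → F}
    (hc : ∑ i, c i • ![1, u, j, u * j] i ∈ quatIntegers h2 hdim) (i : Fin 4) :
    valuation F (c i) ≤ 1 := by
  have hΔ0 : quatTrd F u ^ 2 - 4 * quatNrd F u ≠ 0 := by
    intro h
    rw [h, map_zero] at hΔ
    exact zero_ne_one hΔ
  have hϖ0 : valuation F (ϖ : F) ≠ 0 := by
    simpa using hϖ.ne_zero
  have hϖ1 : valuation F (ϖ : F) < 1 := Valuation.integer.v_irreducible_lt_one hϖ
  have he : valuation F (-quatNrd F j) = valuation F (ϖ : F) := by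
    rw [Valuation.map_neg]
    exact hj
  have h2le : valuation F (2 : F) ≤ 1 := (2 : 𝒪[F]).2
  have ht : valuation F (quatTrd F u) ≤ 1 := valuation_quatTrd_le_one h2 hdim hu
  have hn : valuation F (quatNrd F u) ≤ 1 := hu
  have htr := quatTrd_sum_smul_mul h2 hdim huj hΔ0 c
  set x := ∑ i, c i • ![1, u, j, u * j] i
  have hx1 := valuation_quatTrd_le_one h2 hdim (mul_mem hc (one_mem _))
  have hxu := valuation_quatTrd_le_one h2 hdim (mul_mem hc hu)
  -- Traces against j and uj are divisible by ϖ, which cancels the factor e in the lower block of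
  -- the Gram matrix.
  have hlt {y : H} (hy : y ∈ quatIntegers h2 hdim) :
      valuation F (quatTrd F (y * j)) ≤ valuation F (ϖ : F) := by
    rw [← valuation_lt_one_iff_le_irreducible hϖ]
    apply valuation_quatTrd_lt_one h2 hdim
    rw [map_mul, hj]
    exact mul_lt_one_of_nonneg_of_lt_one_right hy zero_le hϖ1
  have hxj := hlt hc
  have hxuj := hlt (mul_mem hc hu)
  have e0 := htr 0
  have e1 := htr 1
  have e2 := htr 2
  have e3 := htr 3
  simp only [quatGram, Fin.sum_univ_four, Matrix.of_apply, Matrix.cons_val] at e0 e1 e2 e3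
  rw [e0] at hx1
  rw [e1] at hxu
  rw [e2] at hxj
  rw [mul_assoc, e3] at hxuj
  generalize quatTrd F u = t at *
  generalize quatNrd F u = n at *
  generalize -quatNrd F j = e at *
  have hdiv {a : F} (h : valuation F (e * a) ≤ valuation F (ϖ : F)) : valuation F a ≤ 1 := by
    rw [map_mul, he] at h
    exact (mul_le_iff_le_one_right (zero_lt_iff.2 hϖ0)).1 h
  -- The upper block, and the lower block divided by e, have determinants Δ and -Δ, both units.
  have h01 := valuation_le_one_of_det_eq_one (p := 2) (q := t) (r := t ^ 2 - 2 * n)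
    (a := c 0) (b := c 1) (by rw [← hΔ]; congr 1; ring) h2le ht
    (Valuation.map_sub_le (v := valuation F) (by rw [map_pow]; exact pow_le_one' ht 2)
      (by rw [map_mul]; exact mul_le_one' h2le hn))
    (by convert hx1 using 2; ring) (by convert hxu using 2; ring)
  have h23 := valuation_le_one_of_det_eq_one (p := 2) (q := t) (r := 2 * n)
    (a := c 2) (b := c 3) (by rw [← hΔ, ← Valuation.map_neg]; congr 1; ring) h2le ht
    (by rw [map_mul]; exact mul_le_one' h2le hn)
    (hdiv (by convert hxj using 2; ring)) (hdiv (by convert hxuj using 2; ring))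
  fin_cases i
  exacts [h01.1, h01.2, h23.1, h23.2]

/-- The basis 1, u, j, uj gives a determinant of value |ϖ|². Any other integral quadruple multiplies
it by the square of an integral determinant. -/
theorem traceFormDisc_quatIntegers : traceFormDisc (quatIntegers h2 hdim) = 𝓂[F] ^ 2 := by
  obtain ⟨ϖ, hϖ⟩ := IsDiscreteValuationRing.exists_irreducible 𝒪[F]
  obtain ⟨u, j, hu, hΔ, huj, hj⟩ := exists_unramified_and_uniformizer h2 hdim hϖ
  have hΔ0 : quatTrd F u ^ 2 - 4 * quatNrd F u ≠ 0 := by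
    intro h
    rw [h, map_zero] at hΔ
    exact zero_ne_one hΔ
  have hj0 : j ≠ 0 := by
    rintro rfl
    rw [map_zero, eq_comm, map_eq_zero] at hj
    exact hϖ.ne_zero (Subtype.ext hj)
  have hjO : j ∈ quatIntegers h2 hdim := by
    rw [mem_quatIntegers, hj]
    exact ϖ.2
  let b : Basis (Fin 4) F H := basisOfLinearIndependentOfCardEqFinrank
    (linearIndependent_unramified_uniformizer h2 hdim huj hΔ0 hj0) (by simp [hdim])
  have hb : (b : Fin 4 → H) = ![1, u, j, u * j] :=
    coe_basisOfLinearIndependentOfCardEqFinrank _ _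
  set G := quatGram (quatTrd F u) (quatNrd F u) (-quatNrd F j) with hG
  have hdetv : valuation F G.det = valuation F ((ϖ ^ 2 : 𝒪[F]) : F) := by
    rw [hG, det_quatGram, map_mul, Valuation.map_neg, map_pow, hΔ, one_pow, one_mul, map_pow,
      Valuation.map_neg, ← quatValuation_apply h2 hdim, hj]
    simp
  rw [hϖ.maximalIdeal_eq, Ideal.span_singleton_pow]
  apply le_antisymm
  · rw [traceFormDisc, Ideal.span_le]
    rintro d ⟨x, hx, hd⟩
    have hcoord (i k : Fin 4) : valuation F (b.repr (x i) k) ≤ 1 := by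
      apply valuation_coord_le_one h2 hdim hϖ hu hΔ huj hj (c := b.repr (x i))
      rw [← hb, b.sum_repr]
      exact hx i
    let P : Matrix (Fin 4) (Fin 4) 𝒪[F] := Matrix.of fun i k => ⟨b.repr (x i) k, hcoord i k⟩
    let P' : Matrix (Fin 4) (Fin 4) F := Matrix.of fun i k => b.repr (x i) k
    have hP : P'.det = (P.det : F) := by
      have h := RingHom.map_det (Subring.subtype 𝒪[F]) P
      exact h.symm
    -- Change of basis for a bilinear form: the rows of P' are the coordinates of the x i.
    have hgram : (Matrix.of fun i k => quatTrd F (x i * x k)) = P' * G * P'.transpose := by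
      ext i k
      have hxk : quatTrd F (x i * x k) = ∑ l, quatTrd F (x i * b l) * b.repr (x k) l := by
        conv_lhs => rw [← b.sum_repr (x k)]
        rw [Finset.mul_sum, ← quatTrdLinear_apply, map_sum]
        refine Finset.sum_congr rfl fun l _ => ?_
        rw [mul_smul_comm, map_smul, quatTrdLinear_apply, smul_eq_mul, mul_comm]
      have hxi (l : Fin 4) : quatTrd F (x i * b l) = (P' * G) i l := by
        have h := quatTrd_sum_smul_mul h2 hdim huj hΔ0 (b.repr (x i)) l
        rw [← hb, b.sum_repr] at h
        exact h
      rw [Matrix.of_apply, hxk, Matrix.mul_apply]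
      exact Finset.sum_congr rfl fun l _ => by rw [hxi]; rfl
    rw [hgram, Matrix.det_mul, Matrix.det_mul, Matrix.det_transpose, hP] at hd
    rw [SetLike.mem_coe, Ideal.mem_span_singleton]
    apply (Valuation.integer.integers (valuation F)).dvd_of_le
    change valuation F (d : F) ≤ valuation F ((ϖ ^ 2 : 𝒪[F]) : F)
    rw [hd, map_mul, map_mul, hdetv]
    have hP1 : valuation F (P.det : F) ≤ 1 := P.det.2
    exact (mul_le_of_le_one_right' hP1).trans (mul_le_of_le_one_left' hP1)
  · have hdetO : G.det ∈ 𝒪[F] := by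
      rw [Valuation.mem_integer_iff, hdetv]
      exact (ϖ ^ 2 : 𝒪[F]).2
    have hmem : (⟨G.det, hdetO⟩ : 𝒪[F]) ∈
        traceFormDisc (quatIntegers h2 hdim) := by
      apply Ideal.subset_span
      refine ⟨![1, u, j, u * j], ?_, ?_⟩
      · intro i
        fin_cases i
        exacts [one_mem _, hu, hjO, mul_mem hu hjO]
      · refine congrArg Matrix.det ?_
        ext i k
        exact (quatTrd_mul_eq_quatGram h2 hdim huj hΔ0 i k).symm
    rw [Ideal.span_singleton_le_iff_mem]
    exact Ideal.mem_of_dvd _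
      ((Valuation.integer.integers (valuation F)).dvd_of_le hdetv.ge) hmem

theorem orderDisc_quatIntegers : orderDisc (quatIntegers h2 hdim) = 𝓂[F] := by
  rw [orderDisc, traceFormDisc_quatIntegers]
  have : {I : Ideal 𝒪[F] | I ^ 2 = 𝓂[F] ^ 2} = {𝓂[F]} :=
    Set.ext fun I => ⟨fun h => ideal_eq_of_sq_eq_sq h, fun h => by rw [h]; rfl⟩
  rw [this, sSup_singleton]

end Discriminant

theorem mainTheorem2 {F : Type*} [Field F] [ValuativeRel F] [TopologicalSpace F]
    [IsNonarchimedeanLocalField F] (hchar : (2 : F) ≠ 0)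
    {H : Type*} [DivisionRing H] [Algebra F H] [Algebra.IsCentral F H]
    (hdim : Module.finrank F H = 4)
    (σ : H →ₗ[F] H) (hσ : IsOrthogonalInvolution σ) :
    ∃ O : Subalgebra 𝒪[F] H,
      (O : Set H) = {h : H | quatNrd F h ∈ 𝒪[F]} ∧
      (∀ O' : Subalgebra 𝒪[F] H, IsMaximalInvolutionOrder σ O' ↔ O' = O) ∧
      (∀ O' : Subalgebra 𝒪[F] H, IsMaximalOrder O' ↔ O' = O) ∧
      orderDisc O = 𝓂[F] ∧
      𝓂[F] = quatDisc F H ⊓ squareClassIdeal (involutionDisc σ) := by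
  refine ⟨quatIntegers hchar hdim, rfl, fun O' => hσ.isMaximalInvolutionOrder_iff hchar hdim,
    fun O' => isMaximalOrder_iff hchar hdim, orderDisc_quatIntegers hchar hdim, ?_⟩
  rw [quatDisc_eq_maximalIdeal, inf_eq_left.2 (maximalIdeal_le_squareClassIdeal _)]
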